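/- Define $f:[0,\infty)\to[0,\infty)$ by $f(t)=1$ if $t\in[2^n,2^n+1)$ for some integer $n\ge 1$, and $f(t)=t$ otherwise. Consider the frog model on $\mathbb{R}$ with leftward drift $\lambda=\tfrac12$ and intensity $f$: at time $0$ one active frog is at the origin, and sleeping frogs are located at the points of a Poisson process on $[0,\infty)$ with intensity $f$; an active frog moves, from the moment it becomes active, as a Brownian motion $B_s-\lambda s$ started at its initial position; a sleeping frog becomes active as soon as an active frog arrives at its position; the Brownian motions of the different frogs are independent of each other and of the Poisson process. The model is called transient if the probability that the origin is hit by infinitely many different frogs is $0$, and non-transient if this probability is positive. Then $f$ is not monotone increasing, $$\int_0^\infty e^{-f(t)}f(t)\,dt=\infty,$$ and yet the model is non-transient. Consequently the equivalence $$\text{the model is transient}\iff\int_0^\infty e^{-f(t)/(2\lambda)}f(t)\,dt=\infty$$ (which is the criterion for transience of the model when the intensity is monotone increasing) fails for this $f$ and $\lambda=\tfrac12$. -/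

import Mathlib

open MeasureTheory ProbabilityTheory Set
open scoped ENNReal NNReal

/-- The number of points of a random sequence `site` that lie in `A ⊆ ℝ`.  The sequence takes
values in `[0, ∞]`; an index `i` with `site i ω = ∞` carries no point, so that the configuration may
also be finite. -/
noncomputable def pointCount {Ω : Type*} (site : ℕ → Ω → ℝ≥0∞) (A : Set ℝ) (ω : Ω) : ℕ∞ :=
  Set.encard {i : ℕ | site i ω ≠ ∞ ∧ (site i ω).toReal ∈ A}

/-- The measure `1_[0, ∞)(x) f(x) dx` on `ℝ`, for a function `f` that is nonnegative on `[0, ∞)`; its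
values outside `[0, ∞)` play no role. -/
noncomputable def intensityMeasure (f : ℝ → ℝ) : Measure ℝ :=
  (volume.restrict (Set.Ici 0)).withDensity fun x => ENNReal.ofReal (f x)

/-- The points of the random sequence `site` form a Poisson process on `[0, ∞)` with intensity
function `f`: the number of points in a set `A` of finite mass is Poisson with mean `∫_A f`, and the
numbers of points in disjoint sets are independent. -/
structure IsPoissonProcess {Ω : Type*} [MeasurableSpace Ω] (f : ℝ → ℝ)
    (site : ℕ → Ω → ℝ≥0∞) (P : Measure Ω) : Prop where
  measurable_site : ∀ i, Measurable (site i)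
  hasLaw_count : ∀ A : Set ℝ, MeasurableSet A → intensityMeasure f A ≠ ∞ →
    HasLaw (pointCount site A)
      ((poissonMeasure (intensityMeasure f A).toNNReal).map (Nat.cast : ℕ → ℕ∞)) P
  indep_count : ∀ (n : ℕ) (A : Fin n → Set ℝ), (∀ k, MeasurableSet (A k)) →
    Pairwise (fun k l => Disjoint (A k) (A l)) →
    iIndepFun (fun k => pointCount site (A k)) P

/-- The randomness driving the frog model on `ℝ` with leftward drift `drift` and Poisson intensity
`f` of sleeping frogs.  The frogs are indexed by `Option ℕ`: `none` is the frog that is active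
from the beginning at the origin, and `some i` is the frog that initially sleeps at `site i`.  Frog
`k` has its own Brownian motion `W k`, which it follows from the moment it is woken up; all these
Brownian motions are independent of each other and of the initial positions. -/
structure FrogModel {Ω : Type*} [MeasurableSpace Ω] (drift : ℝ) (f : ℝ → ℝ)
    (P : Measure Ω) where
  site : ℕ → Ω → ℝ≥0∞
  W : Option ℕ → ℝ≥0 → Ω → ℝ
  poisson_site : IsPoissonProcess f site P
  measurable_W : ∀ k t, Measurable (W k t)
  brownian_W : ∀ k, IsBrownianReal (W k) P
  indep_W : iIndepFun (fun k ω (t : ℝ≥0) => W k t ω) P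
  indep_site_W : IndepFun (fun ω (i : ℕ) => site i ω)
    (fun ω (k : Option ℕ) (t : ℝ≥0) => W k t ω) P

namespace FrogModel

variable {Ω : Type*} [MeasurableSpace Ω] {drift : ℝ} {f : ℝ → ℝ} {P : Measure Ω}

/-- The initial position of a frog (`∞` if there is no frog with this index). -/
def start (M : FrogModel drift f P) : Option ℕ → Ω → ℝ≥0∞
  | none, _ => 0
  | some i, ω => M.site i ω

/-- The position of frog `k` when a time `s` has passed since it was woken up: Brownian motion with
leftward drift, started at the initial position of the frog. -/
noncomputable def path (M : FrogModel drift f P) (k : Option ℕ) (s : ℝ≥0) (ω : Ω) : ℝ :=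
  (M.start k ω).toReal + (M.W k s ω - drift * s)

/-- The time that frog `j` needs, once awake, to arrive for the first time at the initial position
of frog `k` (`∞` if this never happens or if there is no frog `k`). -/
noncomputable def hitTime (M : FrogModel drift f P) (j k : Option ℕ) (ω : Ω) : ℝ≥0∞ :=
  ⨅ (s : ℝ≥0) (_ : M.start k ω ≠ ∞ ∧ M.path j s ω = (M.start k ω).toReal), (s : ℝ≥0∞)

/-- The time at which frog `k` is woken up, if only chains of at most `n` successive wake-ups
beginning with the initially active frog are taken into account. -/
noncomputable def wakeTimeWithin (M : FrogModel drift f P) : ℕ → Option ℕ → Ω → ℝ≥0∞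
  | 0, none, _ => 0
  | 0, some _, _ => ∞
  | n + 1, k, ω => min (M.wakeTimeWithin n k ω) (⨅ j, M.wakeTimeWithin n j ω + M.hitTime j k ω)

/-- The time at which frog `k` is woken up (`∞` if it sleeps forever): the first time at which a
frog that is already awake is at the initial position of frog `k`. -/
noncomputable def wakeTime (M : FrogModel drift f P) (k : Option ℕ) (ω : Ω) : ℝ≥0∞ :=
  ⨅ n, M.wakeTimeWithin n k ω

open Classical in
/-- The position of frog `k` at time `t`: it stays at its initial position until it is woken up,
and performs Brownian motion with drift from then on. -/
noncomputable def position (M : FrogModel drift f P) (k : Option ℕ) (t : ℝ≥0) (ω : Ω) : ℝ :=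
  if M.wakeTime k ω ≤ t then M.path k (t - (M.wakeTime k ω).toNNReal) ω
  else (M.start k ω).toReal

/-- Frog `k` is, at some time at which it is active, at the origin. -/
def VisitsOrigin (M : FrogModel drift f P) (k : Option ℕ) (ω : Ω) : Prop :=
  ∃ t : ℝ≥0, M.wakeTime k ω ≤ t ∧ M.position k t ω = 0

/-- The event that the origin is hit by infinitely many different frogs. -/
def infinitelyManyVisits (M : FrogModel drift f P) : Set Ω :=
  {ω | {k : Option ℕ | M.VisitsOrigin k ω}.Infinite}

/-- Transience: almost surely only finitely many different frogs hit the origin. -/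
def IsTransient (M : FrogModel drift f P) : Prop := P M.infinitelyManyVisits = 0

/-- Non-transience: with positive probability infinitely many different frogs hit the origin. -/
def IsNonTransient (M : FrogModel drift f P) : Prop := 0 < P M.infinitelyManyVisits

end FrogModel

open Classical in
/-- The function that is `1` on each interval `[2 ^ n, 2 ^ n + 1)`, `n ≥ 1`, and is `t` at every
other point `t`; it is considered on `[0, ∞)` only. -/
noncomputable def gapIntensity (t : ℝ) : ℝ :=
  if ∃ n : ℕ, 1 ≤ n ∧ t ∈ Set.Ico ((2 : ℝ) ^ n) ((2 : ℝ) ^ n + 1) then 1 else t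

/-- The integral `∫₀^∞ exp (-f(t) / (2 drift)) f(t) dt`, as an element of `[0, ∞]`, for a function
`f` that is nonnegative on `[0, ∞)`. -/
noncomputable def criterionIntegral (drift : ℝ) (f : ℝ → ℝ) : ℝ≥0∞ :=
  ∫⁻ t in Set.Ici (0 : ℝ), ENNReal.ofReal (Real.exp (-f t / (2 * drift)) * f t)

/-!
Brownian motion with drift `-1/2` gets below every level, so an active frog moves continuously
from its start to the left through the origin: it hits the origin, and it wakes every frog that
starts to the left of its furthest point. Non-transience follows once infinitely many frogs
are woken up with positive probability.

A gap has length one, and a frog jumps over it with a probability that is bounded below: with the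
fixed probability `p = P(W 1 ≥ 4) > 0` a frog is at time `1` at least three units to the right of its
start. The block `[m, m + 2)` contains a unit interval without gap, so it has mass at least `m`
(`le_intensityMeasure_gapIntensity_Ico`). The frogs of the block that jump by three units form a
Poisson number of mean at least `p m`, so that the block contains none of them with probability
at most `exp (-p m)` (`FrogModel.measure_forall_lt_le`). These bounds are summable. Hence for large
`K` there is with positive probability such a frog in every block `[m, m + 2)`, `m ≥ K`. The event
that the first frog gets beyond `K + 2` has positive probability and is independent of the blocks.
On the intersection, the frogs to the left of `m + 2` wake those in `[m + 2, m + 3)` for every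
`m ≥ K`, so that all frogs are woken up (`FrogModel.wakeTime_ne_top_of_chain`).

The integral diverges because `exp (-f) f = exp (-1)` on each of the infinitely many gaps.
-/

namespace FrogModel

variable {Ω : Type*} [MeasurableSpace Ω] {drift : ℝ} {f : ℝ → ℝ} {P : Measure Ω}

/-! ### Waking up along continuous paths -/

lemma hitTime_ne_top (M : FrogModel drift f P) {j k : Option ℕ} {ω : Ω} {s : ℝ≥0}
    (hk : M.start k ω ≠ ∞) (hs : M.path j s ω = (M.start k ω).toReal) :
    M.hitTime j k ω ≠ ∞ :=
  ne_top_of_le_ne_top ENNReal.coe_ne_top (iInf₂_le s ⟨hk, hs⟩)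

lemma wakeTime_none_ne_top (M : FrogModel drift f P) (ω : Ω) : M.wakeTime none ω ≠ ∞ :=
  ne_top_of_le_ne_top ENNReal.zero_ne_top (iInf_le _ 0)

/-- An awake frog wakes every frog whose initial position lies on its path. -/
lemma wakeTime_ne_top_of_path_eq (M : FrogModel drift f P) {j k : Option ℕ} {ω : Ω} {s : ℝ≥0}
    (hj : M.wakeTime j ω ≠ ∞) (hk : M.start k ω ≠ ∞)
    (hs : M.path j s ω = (M.start k ω).toReal) : M.wakeTime k ω ≠ ∞ := by
  obtain ⟨n, hn⟩ : ∃ n, M.wakeTimeWithin n j ω ≠ ∞ := by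
    by_contra! h
    exact hj (by simp [wakeTime, h])
  have hle : M.wakeTime k ω ≤ M.wakeTimeWithin n j ω + M.hitTime j k ω :=
    (iInf_le _ (n + 1)).trans ((min_le_right _ _).trans (iInf_le _ j))
  exact ne_top_of_le_ne_top (ENNReal.add_ne_top.2 ⟨hn, M.hitTime_ne_top hk hs⟩) hle

/-- The frog `k` moves continuously from its initial position and gets arbitrarily far to the
left. -/
structure RegularPath (M : FrogModel drift f P) (k : Option ℕ) (ω : Ω) : Prop where
  continuous : Continuous fun s => M.W k s ω
  zero : M.W k 0 ω = 0
  exists_le : ∀ L : ℕ, ∃ s : ℝ≥0, M.W k s ω - drift * s ≤ -L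

lemma RegularPath.exists_path_eq {M : FrogModel drift f P} {k : Option ℕ} {ω : Ω}
    (h : M.RegularPath k ω) {y : ℝ} {s : ℝ≥0} (hy : y ≤ M.path k s ω) :
    ∃ u : ℝ≥0, M.path k u ω = y := by
  have hc : Continuous fun u => M.path k u ω := by
    have := h.continuous
    unfold path
    fun_prop
  obtain ⟨L, hL⟩ := exists_nat_ge ((M.start k ω).toReal - y)
  obtain ⟨t, ht⟩ := h.exists_le L
  exact mem_range_of_exists_le_of_exists_ge hc ⟨t, by unfold path; linarith⟩ ⟨s, hy⟩

lemma RegularPath.visitsOrigin {M : FrogModel drift f P} {k : Option ℕ} {ω : Ω}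
    (h : M.RegularPath k ω) (hk : M.wakeTime k ω ≠ ∞) : M.VisitsOrigin k ω := by
  obtain ⟨u, hu⟩ := h.exists_path_eq (y := 0) (s := 0) (by simp [path, h.zero])
  have hle : M.wakeTime k ω ≤ (((M.wakeTime k ω).toNNReal + u : ℝ≥0) : ℝ≥0∞) := by
    rw [ENNReal.coe_add, ENNReal.coe_toNNReal hk]
    exact le_self_add
  refine ⟨(M.wakeTime k ω).toNNReal + u, hle, ?_⟩
  rw [position, if_pos hle, add_tsub_cancel_left, hu]

/-- If the first frog gets beyond `K`, and if for every `k ≥ K` some frog that starts in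
`[k - 2, k)` gets at least three units to the right, then every frog is woken up: the frogs in
`[0, K + j)` wake those in `[K + j, K + j + 1)`. -/
lemma wakeTime_ne_top_of_chain (M : FrogModel drift f P) {ω : Ω} {K : ℕ} {t : ℝ≥0}
    (hreg : ∀ k, M.RegularPath k ω) (h0 : (K : ℝ) ≤ M.path none t ω)
    (hstep : ∀ j : ℕ, ∃ i, M.site i ω ≠ ∞ ∧
      (M.site i ω).toReal ∈ Ico ((K + j : ℝ) - 2) (K + j) ∧
      3 ≤ M.W (some i) t ω - drift * t)
    (i : ℕ) (hi : M.site i ω ≠ ∞) : M.wakeTime (some i) ω ≠ ∞ := by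
  have key : ∀ j i : ℕ, M.site i ω ≠ ∞ → (M.site i ω).toReal < K + j →
      M.wakeTime (some i) ω ≠ ∞ := by
    intro j
    induction j with
    | zero =>
      intro i hi hlt
      obtain ⟨u, hu⟩ := (hreg none).exists_path_eq (y := (M.site i ω).toReal) (s := t)
        (by push_cast at hlt; linarith)
      exact M.wakeTime_ne_top_of_path_eq (k := some i) (M.wakeTime_none_ne_top ω) hi hu
    | succ j ih =>
      intro i hi hlt
      obtain ⟨l, hl, hmem, hfar⟩ := hstep j
      obtain ⟨u, hu⟩ := (hreg (some l)).exists_path_eq (y := (M.site i ω).toReal) (s := t) (by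
        have := hmem.1
        push_cast at hlt
        simp only [path, start]
        linarith)
      exact M.wakeTime_ne_top_of_path_eq (k := some i) (ih l hl hmem.2) hi hu
  obtain ⟨j, hj⟩ := exists_nat_gt (M.site i ω).toReal
  exact key j i hi (hj.trans_le (by simp))

lemma mem_infinitelyManyVisits_of_chain (M : FrogModel drift f P) {ω : Ω} {K : ℕ} {t : ℝ≥0}
    (hreg : ∀ k, M.RegularPath k ω) (h0 : (K : ℝ) ≤ M.path none t ω)
    (hstep : ∀ j : ℕ, ∃ i, M.site i ω ≠ ∞ ∧
      (M.site i ω).toReal ∈ Ico ((K + j : ℝ) - 2) (K + j) ∧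
      3 ≤ M.W (some i) t ω - drift * t) :
    ω ∈ M.infinitelyManyVisits := by
  choose g hg hmem hfar using hstep
  -- Frogs from blocks that are two units apart are different.
  have hinj : Function.Injective fun j => some (g (2 * j)) := by
    have hlt : ∀ a b : ℕ, a < b → g (2 * a) ≠ g (2 * b) := by
      intro a b hab heq
      have h1 := (hmem (2 * a)).2
      have h2 := (hmem (2 * b)).1
      rw [heq] at h1
      have : (a : ℝ) + 1 ≤ b := by exact_mod_cast hab
      push_cast at h1 h2
      linarith
    intro a b hab
    have hab' : g (2 * a) = g (2 * b) := Option.some_injective _ hab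
    rcases lt_trichotomy a b with h | h | h
    · exact absurd hab' (hlt a b h)
    · exact h
    · exact absurd hab'.symm (hlt b a h)
  refine (infinite_range_of_injective hinj).mono ?_
  rintro _ ⟨j, rfl⟩
  exact (hreg _).visitsOrigin (M.wakeTime_ne_top_of_chain hreg h0
    (fun j => ⟨g j, hg j, hmem j, hfar j⟩) _ (hg _))

end FrogModel

/-! ### Brownian motion with drift -/

/-- By Chebyshev's inequality at a large time, Brownian motion with drift `-drift < 0` gets
below every level. -/
lemma ae_exists_brownian_sub_le {Ω : Type*} [MeasurableSpace Ω] {P : Measure Ω}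
    [IsProbabilityMeasure P] {B : ℝ≥0 → Ω → ℝ} (hB : IsPreBrownianReal B P) {drift : ℝ}
    (hd : 0 < drift) : ∀ᵐ ω ∂P, ∀ L : ℕ, ∃ s : ℝ≥0, B s ω - drift * s ≤ -L := by
  refine ae_all_iff.2 fun L => ?_
  rw [ae_iff]
  have hbound : ∀ᶠ n : ℕ in Filter.atTop,
      P {ω | ¬ ∃ s : ℝ≥0, B s ω - drift * s ≤ -L} ≤ ENNReal.ofReal (4 / drift ^ 2 / n) := by
    obtain ⟨N, hN⟩ := exists_nat_ge (2 * L / drift)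
    filter_upwards [Filter.eventually_ge_atTop (max N 1)] with n hn
    have hn1 : (1 : ℝ) ≤ n := by exact_mod_cast (le_max_right _ _).trans hn
    have hnN : (N : ℝ) ≤ n := by exact_mod_cast (le_max_left _ _).trans hn
    have hL : 2 * (L : ℝ) ≤ drift * n := by
      have := hN.trans hnN
      rwa [div_le_iff₀ hd, mul_comm (n : ℝ)] at this
    have hlaw := hB.hasLaw_eval (n : ℝ≥0)
    have hLp : MemLp (B n) 2 P := by
      have := memLp_id_gaussianReal (μ := 0) (v := (n : ℝ≥0)) 2
      rw [← hlaw.map_eq] at this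
      exact (memLp_map_measure_iff aestronglyMeasurable_id hlaw.aemeasurable).1 this
    have hcheb := meas_ge_le_variance_div_sq hLp (c := drift * n / 2) (by positivity)
    rw [hB.integral_eval, hlaw.variance_eq, variance_id_gaussianReal] at hcheb
    refine (measure_mono fun ω hω => ?_).trans (hcheb.trans_eq ?_)
    · simp only [mem_ofPred_eq, not_exists, not_le] at hω ⊢
      have := hω n
      rw [sub_zero]
      refine le_trans ?_ (le_abs_self _)
      push_cast at this
      linarith
    · congr 1
      push_cast
      field_simp
      norm_num
  have hlim : Filter.Tendsto (fun n : ℕ => ENNReal.ofReal (4 / drift ^ 2 / n)) Filter.atTop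
      (nhds 0) := by
    rw [← ENNReal.ofReal_zero]
    exact ENNReal.tendsto_ofReal (tendsto_const_div_atTop_nhds_zero_nat _)
  exact le_antisymm (ge_of_tendsto hlim hbound) bot_le

lemma FrogModel.ae_regularPath {Ω : Type*} [MeasurableSpace Ω] {P : Measure Ω}
    [IsProbabilityMeasure P] {drift : ℝ} {f : ℝ → ℝ} (M : FrogModel drift f P) (hd : 0 < drift) :
    ∀ᵐ ω ∂P, ∀ k, M.RegularPath k ω := by
  refine ae_all_iff.2 fun k => ?_
  filter_upwards [(M.brownian_W k).cont, (M.brownian_W k).eval_zero_ae_eq_zero,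
    ae_exists_brownian_sub_le (M.brownian_W k).toIsPreBrownianReal hd] with ω h1 h2 h3
  exact ⟨h1, h2, h3⟩

lemma gaussianReal_Ici_pos (μ : ℝ) {v : ℝ≥0} (hv : v ≠ 0) (a : ℝ) :
    0 < gaussianReal μ v (Ici a) := by
  refine pos_iff_ne_zero.2 fun h => ?_
  simpa using gaussianReal_absolutelyContinuous' μ hv h

/-! ### Independent thinning of a Poisson process -/

/-- The probability generating function of the Poisson distribution. -/
lemma lintegral_pow_poissonMeasure (r : ℝ≥0) {q : ℝ} (hq : 0 ≤ q) :
    ∫⁻ n, ENNReal.ofReal q ^ n ∂(poissonMeasure r) =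
      ENNReal.ofReal (Real.exp (-((1 - q) * r))) := by
  have hs := ((NormedSpace.expSeries_div_hasSum_exp (q * r : ℝ)).mul_left (Real.exp (-r)))
  rw [← Real.exp_eq_exp_ℝ, ← Real.exp_add] at hs
  rw [poissonMeasure, lintegral_sum_measure,
    show -((1 - q) * (r : ℝ)) = -r + q * r by ring, ← hs.tsum_eq,
    ENNReal.ofReal_tsum_of_nonneg (fun n => by positivity) hs.summable]
  congr 1 with n
  rw [lintegral_smul_measure, lintegral_dirac, smul_eq_mul, ← ENNReal.ofReal_pow hq,
    ← ENNReal.ofReal_mul (by positivity)]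
  congr 1
  rw [mul_pow]
  ring

/-- Given that the initially active frog has `W none 1 ≥ a`, the frogs in `B` with `W k 1 ≥ h` are
an independent thinning of the Poisson process, so that there is none with the probability
`exp (-p m)`, where `m` is the mass of `B` and `p` the probability that a standard Gaussian variable
is at least `h`. Conditionally on the sites, the probability is at most `(1 - p) ^ N` with `N` the
number of points in `B`, and `N` is Poisson. -/
lemma FrogModel.measure_forall_lt_le {Ω : Type*} [MeasurableSpace Ω] {P : Measure Ω}
    [IsProbabilityMeasure P] {drift : ℝ} {f : ℝ → ℝ} (M : FrogModel drift f P) {B : Set ℝ}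
    (hB : MeasurableSet B) (hfin : intensityMeasure f B ≠ ∞) (a h : ℝ) :
    P {ω | a ≤ M.W none 1 ω ∧
      ∀ i, M.site i ω ≠ ∞ → (M.site i ω).toReal ∈ B → M.W (some i) 1 ω < h} ≤
    gaussianReal 0 1 (Ici a) * ENNReal.ofReal
      (Real.exp (-((gaussianReal 0 1).real (Ici h) * (intensityMeasure f B).toReal))) := by
  set G := gaussianReal 0 1
  set q : ℝ := 1 - G.real (Ici h)
  have hq0 : 0 ≤ q := sub_nonneg.2 measureReal_le_one
  have hGq : G (Iio h) = ENNReal.ofReal q := by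
    rw [← compl_Ici, ← ofReal_measureReal (measure_ne_top _ _),
      probReal_compl_eq_one_sub measurableSet_Ici]
  let S : Ω → ℕ → ℝ≥0∞ := fun ω i => M.site i ω
  let V : Ω → Option ℕ → ℝ := fun ω k => M.W k 1 ω
  have hS : Measurable S := measurable_pi_lambda _ M.poisson_site.measurable_site
  have hV : Measurable V := measurable_pi_lambda _ fun k => M.measurable_W k 1
  have hSV : IndepFun S V P := by
    have hψ : Measurable fun (w : Option ℕ → ℝ≥0 → ℝ) k => w k 1 := by fun_prop
    exact M.indep_site_W.comp measurable_id hψ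
  have hVi : iIndepFun (fun k ω => V ω k) P :=
    M.indep_W.comp (fun _ w => w 1) (fun _ => by fun_prop)
  have hVlaw : ∀ k {A : Set ℝ}, MeasurableSet A → P ((fun ω => V ω k) ⁻¹' A) = G A := by
    intro k A hA
    exact ((M.brownian_W k).hasLaw_eval 1).measure_eq hA
  let T : Set ((ℕ → ℝ≥0∞) × (Option ℕ → ℝ)) :=
    {z | a ≤ z.2 none ∧ ∀ i, z.1 i ≠ ∞ → (z.1 i).toReal ∈ B → z.2 (some i) < h}
  have hT : MeasurableSet T := by
    have hA : ∀ i, MeasurableSet {z : (ℕ → ℝ≥0∞) × (Option ℕ → ℝ) | z.1 i ≠ ∞} := fun i =>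
      (measurableSet_eq_fun (by fun_prop) measurable_const).compl
    have hA' : ∀ i, MeasurableSet {z : (ℕ → ℝ≥0∞) × (Option ℕ → ℝ) | (z.1 i).toReal ∈ B} :=
      fun i => (ENNReal.measurable_toReal.comp ((measurable_pi_apply i).comp measurable_fst)) hB
    have hA'' : ∀ i, MeasurableSet {z : (ℕ → ℝ≥0∞) × (Option ℕ → ℝ) | z.2 (some i) < h} :=
      fun i => measurableSet_lt (by fun_prop) measurable_const
    have hA0 : MeasurableSet {z : (ℕ → ℝ≥0∞) × (Option ℕ → ℝ) | a ≤ z.2 none} :=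
      measurableSet_le measurable_const (by fun_prop)
    have hm := hA0.inter (MeasurableSet.iInter fun i => (hA i).imp ((hA' i).imp (hA'' i)))
    simpa only [T, ofPred_and, ofPred_forall] using hm
  have hprod : P {ω | a ≤ M.W none 1 ω ∧
      ∀ i, M.site i ω ≠ ∞ → (M.site i ω).toReal ∈ B → M.W (some i) 1 ω < h} =
      ∫⁻ ω, P {ω' | (S ω, V ω') ∈ T} ∂P := by
    have h1 : P {ω | (S ω, V ω) ∈ T} = P.map (fun ω => (S ω, V ω)) T :=
      (Measure.map_apply (hS.prodMk hV) hT).symm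
    rw [hSV.map_prod_eq_prod_map_map hS.aemeasurable hV.aemeasurable, Measure.prod_apply hT,
      lintegral_map (measurable_measure_prodMk_left hT) hS] at h1
    refine h1.trans (lintegral_congr fun ω => ?_)
    rw [Measure.map_apply hV (measurable_prodMk_left hT)]
    rfl
  -- For infinitely many points the exponent is the junk value `0`, and the bound still holds.
  have hsec : ∀ ω, P {ω' | (S ω, V ω') ∈ T} ≤
      G (Ici a) * ENNReal.ofReal q ^ (pointCount M.site B ω).toNat := by
    intro ω
    by_cases hI : {i : ℕ | M.site i ω ≠ ∞ ∧ (M.site i ω).toReal ∈ B}.Finite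
    · let A : Option ℕ → Set ℝ := fun k => k.elim (Ici a) fun _ => Iio h
      have hA : ∀ k, MeasurableSet (A k) := by
        rintro (_ | i)
        · exact measurableSet_Ici
        · exact measurableSet_Iio
      have hind := hVi.measure_inter_preimage_eq_mul (Finset.insertNone hI.toFinset)
        (sets := A) (fun k _ => hA k)
      rw [Finset.prod_insertNone, hVlaw none (hA none),
        Finset.prod_congr rfl fun i _ => (hVlaw (some i) (hA (some i))).trans hGq,
        Finset.prod_const] at hind
      rw [pointCount, hI.encard_eq_coe_toFinset_card, ENat.toNat_natCast]
      refine (measure_mono fun ω' hω' => ?_).trans hind.le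
      simp only [mem_iInter]
      rintro (_ | i) hk
      · exact hω'.1
      · have : i ∈ hI.toFinset := by simpa using hk
        rw [Finite.mem_toFinset] at this
        exact hω'.2 i this.1 this.2
    · rw [pointCount, Set.Infinite.encard_eq hI, ENat.toNat_top, pow_zero, mul_one,
        ← hVlaw none measurableSet_Ici]
      exact measure_mono fun ω' hω' => hω'.1
  rw [hprod]
  refine (lintegral_mono hsec).trans_eq ?_
  rw [lintegral_const_mul']
  · congr 1
    rw [(M.poisson_site.hasLaw_count B hB hfin).lintegral_comp
      (f := fun n => ENNReal.ofReal q ^ n.toNat) Measurable.of_discrete.aemeasurable,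
      lintegral_map Measurable.of_discrete Measurable.of_discrete]
    simp only [ENat.toNat_natCast]
    rw [lintegral_pow_poissonMeasure _ hq0]
    simp [q, ENNReal.coe_toNNReal_eq_toReal]
  · exact measure_ne_top _ _

/-! ### The intensity -/

lemma gapIntensity_le {t : ℝ} {C : ℝ} (h1 : 1 ≤ C) (ht : t ≤ C) : gapIntensity t ≤ C := by
  unfold gapIntensity
  split_ifs <;> assumption

lemma gapIntensity_eq_one {n : ℕ} (hn : 1 ≤ n) {t : ℝ}
    (ht : t ∈ Ico ((2 : ℝ) ^ n) ((2 : ℝ) ^ n + 1)) : gapIntensity t = 1 :=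
  if_pos ⟨n, hn, ht⟩

lemma gapIntensity_eq_self {m : ℕ} (hm : ∀ n, 1 ≤ n → m ≠ 2 ^ n) {t : ℝ}
    (ht : t ∈ Ico (m : ℝ) (m + 1)) : gapIntensity t = t := by
  refine if_neg ?_
  rintro ⟨n, hn, h1, h2⟩
  refine hm n hn (le_antisymm ?_ ?_)
  · have : (m : ℝ) < 2 ^ n + 1 := ht.1.trans_lt h2
    exact Nat.lt_succ_iff.1 (by exact_mod_cast this)
  · have : (2 : ℝ) ^ n < m + 1 := h1.trans_lt ht.2
    exact Nat.lt_succ_iff.1 (by exact_mod_cast this)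

lemma intensityMeasure_apply_Ico (f : ℝ → ℝ) {a b : ℝ} (ha : 0 ≤ a) :
    intensityMeasure f (Ico a b) = ∫⁻ t in Ico a b, ENNReal.ofReal (f t) := by
  rw [intensityMeasure, withDensity_apply _ measurableSet_Ico,
    Measure.restrict_restrict measurableSet_Ico, inter_eq_left.2]
  exact fun t ht => ha.trans ht.1

lemma intensityMeasure_gapIntensity_Ico_ne_top {a b : ℝ} (ha : 0 ≤ a) :
    intensityMeasure gapIntensity (Ico a b) ≠ ∞ := by
  rw [intensityMeasure_apply_Ico _ ha]
  have : ∫⁻ t in Ico a b, ENNReal.ofReal (gapIntensity t) ≤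
      ∫⁻ _ in Ico a b, ENNReal.ofReal (max 1 b) :=
    setLIntegral_mono' measurableSet_Ico fun t ht =>
      ENNReal.ofReal_le_ofReal (gapIntensity_le (le_max_left _ _) (ht.2.le.trans (le_max_right _ _)))
  refine ne_top_of_le_ne_top ?_ this
  simp [ENNReal.mul_eq_top]

lemma le_intensityMeasure_gapIntensity_Ico_of_forall_ne {m : ℕ} (hm : ∀ n, 1 ≤ n → m ≠ 2 ^ n) :
    (m : ℝ≥0∞) ≤ intensityMeasure gapIntensity (Ico (m : ℝ) (m + 1)) := by
  rw [intensityMeasure_apply_Ico _ m.cast_nonneg]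
  have : ∫⁻ _ in Ico (m : ℝ) (m + 1), (m : ℝ≥0∞) ≤
      ∫⁻ t in Ico (m : ℝ) (m + 1), ENNReal.ofReal (gapIntensity t) := by
    refine setLIntegral_mono' measurableSet_Ico fun t ht => ?_
    rw [gapIntensity_eq_self hm ht, ← ENNReal.ofReal_natCast]
    exact ENNReal.ofReal_le_ofReal ht.1
  simpa using this

/-- Of two consecutive unit intervals, at most one is a gap. -/
lemma le_intensityMeasure_gapIntensity_Ico (m : ℕ) :
    (m : ℝ≥0∞) ≤ intensityMeasure gapIntensity (Ico (m : ℝ) (m + 2)) := by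
  by_cases h : ∀ n, 1 ≤ n → m ≠ 2 ^ n
  · exact (le_intensityMeasure_gapIntensity_Ico_of_forall_ne h).trans
      (measure_mono (Ico_subset_Ico_right (by linarith)))
  · push Not at h
    obtain ⟨k, hk, rfl⟩ := h
    have h' : ∀ n, 1 ≤ n → 2 ^ k + 1 ≠ 2 ^ n := by
      intro n hn heq
      obtain ⟨k, rfl⟩ := Nat.exists_eq_add_of_le' hk
      obtain ⟨n, rfl⟩ := Nat.exists_eq_add_of_le' hn
      rw [pow_succ, pow_succ] at heq
      omega
    refine le_trans ?_ ((le_intensityMeasure_gapIntensity_Ico_of_forall_ne h').trans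
      (measure_mono (Ico_subset_Ico ?_ ?_)))
    · push_cast; exact le_self_add
    · push_cast; linarith
    · push_cast; linarith

lemma not_monotoneOn_gapIntensity : ¬ MonotoneOn gapIntensity (Ici 0) := by
  intro h
  have h1 : gapIntensity (3 / 2) = 3 / 2 :=
    gapIntensity_eq_self (m := 1) (fun n hn h => (Nat.one_lt_two_pow (by omega)).ne h)
      (by norm_num)
  have h2 : gapIntensity 2 = 1 := gapIntensity_eq_one le_rfl (by norm_num)
  have := h (show (3 / 2 : ℝ) ∈ Ici 0 by norm_num) (show (2 : ℝ) ∈ Ici 0 by norm_num)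
    (by norm_num)
  rw [h1, h2] at this
  norm_num at this

/-- Each of the infinitely many gaps contributes `exp (-1)` to the integral. -/
lemma lintegral_exp_neg_gapIntensity :
    ∫⁻ t in Ici (0 : ℝ), ENNReal.ofReal (Real.exp (-gapIntensity t) * gapIntensity t) = ∞ := by
  let J : ℕ → Set ℝ := fun n => Ico ((2 : ℝ) ^ (n + 1)) ((2 : ℝ) ^ (n + 1) + 1)
  have hmono : ∀ a b : ℕ, a < b → Disjoint (J a) (J b) := by
    intro a b hab
    refine disjoint_left.2 fun t h1 h2 => ?_
    have h3 : (2 : ℝ) ^ (a + 1) * 2 ≤ 2 ^ (b + 1) := by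
      rw [← pow_succ]
      exact pow_le_pow_right₀ one_le_two (by omega)
    have h4 : (1 : ℝ) ≤ 2 ^ (a + 1) := one_le_pow₀ one_le_two
    linarith [h1.2, h2.1]
  have hdisj : Pairwise (Function.onFun Disjoint J) := fun a b hab =>
    hab.lt_or_gt.elim (hmono a b) fun h => (hmono b a h).symm
  have hJ : ∀ n, ∫⁻ t in J n, ENNReal.ofReal (Real.exp (-gapIntensity t) * gapIntensity t) =
      ENNReal.ofReal (Real.exp (-1)) := by
    intro n
    rw [setLIntegral_congr_fun (g := fun _ => ENNReal.ofReal (Real.exp (-1))) measurableSet_Ico]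
    · simp
    · intro t ht
      simp only [gapIntensity_eq_one (Nat.le_add_left 1 n) ht, mul_one]
  have hsub : ⋃ n, J n ⊆ Ici 0 :=
    iUnion_subset fun n t ht => le_trans (by positivity) ht.1
  refine top_le_iff.1 (le_trans ?_ (lintegral_mono_set hsub))
  rw [lintegral_iUnion (fun n => measurableSet_Ico) hdisj, tsum_congr hJ,
    ENNReal.tsum_const_eq_top_of_ne_zero (ENNReal.ofReal_pos.2 (Real.exp_pos _)).ne']

/-! ### Non-transience -/

lemma FrogModel.isNonTransient_gapIntensity {Ω : Type*} [MeasurableSpace Ω] {P : Measure Ω}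
    [IsProbabilityMeasure P] (M : FrogModel (1 / 2) gapIntensity P) : M.IsNonTransient := by
  set G := gaussianReal 0 1
  -- A frog with `W k 1 ≥ 4` is at time `1` at least three units to the right of its start.
  set p : ℝ := G.real (Ici 4)
  have hp : 0 < p := ENNReal.toReal_pos (gaussianReal_Ici_pos 0 one_ne_zero 4).ne'
    (measure_ne_top _ _)
  have hsum : Summable fun n : ℕ => Real.exp (-(p * n)) := by
    have := Real.summable_exp_nat_mul_iff.2 (neg_lt_zero.2 hp)
    refine this.congr fun n => ?_
    congr 1
    ring
  obtain ⟨K, hK⟩ : ∃ K : ℕ, ∑' j : ℕ, Real.exp (-(p * (j + K : ℕ))) < 1 :=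
    ((tendsto_sum_nat_add fun n : ℕ => Real.exp (-(p * n))).eventually
      (gt_mem_nhds one_pos)).exists
  let A : Set Ω := {ω | (K + 3 : ℝ) ≤ M.W none 1 ω}
  let Bad : ℕ → Set Ω := fun j => {ω | (K + 3 : ℝ) ≤ M.W none 1 ω ∧
    ∀ i, M.site i ω ≠ ∞ → (M.site i ω).toReal ∈ Ico ((j + K : ℕ) : ℝ) ((j + K : ℕ) + 2) →
      M.W (some i) 1 ω < 4}
  have hA : P A = G (Ici (K + 3 : ℝ)) :=
    ((M.brownian_W none).hasLaw_eval 1).measure_eq measurableSet_Ici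
  have hBad : P (⋃ j, Bad j) < P A := by
    calc P (⋃ j, Bad j) ≤ ∑' j, P (Bad j) := measure_iUnion_le _
      _ ≤ ∑' j : ℕ, P A * ENNReal.ofReal (Real.exp (-(p * (j + K : ℕ)))) := by
        refine ENNReal.tsum_le_tsum fun j => ?_
        have hfin : intensityMeasure gapIntensity (Ico ((j + K : ℕ) : ℝ) ((j + K : ℕ) + 2)) ≠ ∞ :=
          intensityMeasure_gapIntensity_Ico_ne_top (Nat.cast_nonneg _)
        refine (M.measure_forall_lt_le measurableSet_Ico hfin _ _).trans ?_
        rw [hA]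
        gcongr
        have := ENNReal.toReal_mono hfin (le_intensityMeasure_gapIntensity_Ico (j + K))
        rwa [ENNReal.toReal_natCast] at this
      _ = P A * ENNReal.ofReal (∑' j : ℕ, Real.exp (-(p * (j + K : ℕ)))) := by
        rw [ENNReal.tsum_mul_left, ENNReal.ofReal_tsum_of_nonneg (fun _ => (Real.exp_pos _).le)
          ((summable_nat_add_iff K).2 hsum)]
      _ < P A * 1 := by
        refine ENNReal.mul_lt_mul_right (hA ▸ (gaussianReal_Ici_pos 0 one_ne_zero _).ne')
          (measure_ne_top _ _) ?_
        rwa [← ENNReal.ofReal_one, ENNReal.ofReal_lt_ofReal_iff one_pos]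
      _ = P A := mul_one _
  refine pos_iff_ne_zero.2 fun hzero => hBad.not_ge ?_
  have hae : ∀ᵐ ω ∂P, ω ∈ A → ω ∈ ⋃ j, Bad j := by
    filter_upwards [M.ae_regularPath one_half_pos, measure_eq_zero_iff_ae_notMem.1 hzero]
      with ω hreg hω hωA
    by_contra hgood
    refine hω (M.mem_infinitelyManyVisits_of_chain (K := K + 2) (t := 1) hreg ?_ fun j => ?_)
    · have : (K + 3 : ℝ) ≤ M.W none 1 ω := hωA
      simp only [path, start]
      push_cast
      norm_num
      linarith
    · have hj : ω ∉ Bad j := fun h => hgood (mem_iUnion.2 ⟨j, h⟩)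
      simp only [Bad, mem_ofPred_eq, not_and, not_forall, not_lt] at hj
      obtain ⟨i, hi, hmem, hfar⟩ := hj hωA
      refine ⟨i, hi, ?_, ?_⟩
      · convert hmem using 2 <;> push_cast <;> ring
      · push_cast
        linarith
  exact measure_mono_ae hae

theorem mainTheorem5 :
    ¬ MonotoneOn gapIntensity (Set.Ici 0) ∧
    (∫⁻ t in Set.Ici (0 : ℝ), ENNReal.ofReal (Real.exp (-gapIntensity t) * gapIntensity t)) = ∞ ∧
    ∀ {Ω : Type*} [MeasurableSpace Ω] (P : Measure Ω) [IsProbabilityMeasure P]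
      (M : FrogModel (1 / 2) gapIntensity P),
      M.IsNonTransient ∧
      ¬ (M.IsTransient ↔ criterionIntegral (1 / 2) gapIntensity = ∞) := by
  refine ⟨not_monotoneOn_gapIntensity, lintegral_exp_neg_gapIntensity, fun P _ M => ?_⟩
  have hM := M.isNonTransient_gapIntensity
  have hint : criterionIntegral (1 / 2) gapIntensity = ∞ := by
    rw [criterionIntegral, ← lintegral_exp_neg_gapIntensity]
    norm_num
  exact ⟨hM, fun h => hM.ne' (h.2 hint)⟩
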